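/- Let $\kappa$ be an uncountable regular cardinal. Then there exists a $\kappa$-Aronszajn tree if and only if there exists a $(\kappa,\kappa)$-connected graph with exactly $\kappa$ vertices that has no $K_\kappa$ minor. Here graphs are simple and undirected, and the following definitions are used. A tree is a partially ordered set $(T,\le)$ in which $\{s\in T : s<t\}$ is well-ordered for every $t\in T$; the order type of this set is the height of $t$, the level $T_\alpha$ is the set of nodes of height $\alpha$, and the height of $T$ is the least ordinal greater than the heights of all its nodes. A branch is a maximal chain, and a $\kappa$-branch is a branch of order type $\kappa$. A $\kappa$-Aronszajn tree is a tree of height $\kappa$ all of whose levels have size less than $\kappa$ and which has no $\kappa$-branch. For infinite cardinals $\kappa,\lambda$, a graph is $(\kappa,\lambda)$-connected if, after the removal of any set of fewer than $\kappa$ vertices (possibly none), the number of connected components of the remaining graph is non-zero and less than $\lambda$. $K_\kappa$ is the complete graph on $\kappa$ vertices. A graph $G$ has a $K_\kappa$ minor if there are $\kappa$ many pairwise disjoint non-empty sets of vertices of $G$, each inducing a connected subgraph of $G$, such that any two of them are joined by an edge of $G$. -/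

import Mathlib

universe u v

/-- A tree in the sense of set theory: a partially ordered set in which the set of predecessors
`{s | s < t}` of every node `t` is well-ordered. -/
class IsOrderTree (T : Type u) [PartialOrder T] : Prop where
  isWellOrder_Iio (t : T) : IsWellOrder (Set.Iio t) (· < ·)

attribute [instance] IsOrderTree.isWellOrder_Iio

namespace IsOrderTree

variable {T : Type u} [PartialOrder T] [IsOrderTree T]

/-- The height of a node `t` of a tree: the order type of `{s | s < t}`. -/
noncomputable def nodeHeight (t : T) : Ordinal.{u} :=
  Ordinal.type (fun x y : Set.Iio t => x < y)

variable (T)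

/-- The level `α` of a tree: the set of nodes of height `α`. -/
def level (α : Ordinal.{u}) : Set T :=
  {t : T | nodeHeight t = α}

/-- The height of a tree: the least ordinal greater than the heights of all nodes. -/
noncomputable def height : Ordinal.{u} :=
  ⨆ t : T, Order.succ (nodeHeight t)

end IsOrderTree

/-- A `κ`-branch of a tree: a maximal chain of order type `κ`. -/
def IsCardinalBranch {T : Type u} [PartialOrder T] (κ : Cardinal.{u}) (b : Set T) : Prop :=
  IsMaxChain (· ≤ ·) b ∧ Nonempty (b ≃o Set.Iio κ.ord)

/-- A `κ`-Aronszajn tree: a tree of height `κ` all of whose levels have size less than `κ` and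
which has no `κ`-branch. -/
structure IsAronszajnTree (κ : Cardinal.{u}) (T : Type u) [PartialOrder T] [IsOrderTree T] :
    Prop where
  height_eq : IsOrderTree.height T = κ.ord
  mk_level_lt (α : Ordinal.{u}) : Cardinal.mk (IsOrderTree.level T α) < κ
  not_isCardinalBranch (b : Set T) : ¬ IsCardinalBranch κ b

/-- `G` is a minor of `H`: there are pairwise disjoint nonempty sets `X u` of vertices of `H`,
indexed by the vertices of `G`, each inducing a connected subgraph of `H`, such that whenever `u`
and `v` are adjacent in `G` some edge of `H` joins `X u` to `X v`. -/
def IsGraphMinor {U : Type u} {V : Type v} (G : SimpleGraph U) (H : SimpleGraph V) : Prop :=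
  ∃ X : U → Set V,
    (∀ a, (X a).Nonempty) ∧
    (∀ a b, a ≠ b → Disjoint (X a) (X b)) ∧
    (∀ a, (H.induce (X a)).Connected) ∧
    ∀ a b, G.Adj a b → ∃ x ∈ X a, ∃ y ∈ X b, H.Adj x y

/-- `G` is `(κ, μ)`-connected: after the removal of any set of fewer than `κ` vertices, the number
of connected components is nonzero and less than `μ`. -/
def IsCardinalConnected {V : Type u} (κ μ : Cardinal.{u}) (G : SimpleGraph V) : Prop :=
  ∀ S : Set V, Cardinal.mk S < κ →
    Cardinal.mk (G.induce Sᶜ).ConnectedComponent ≠ 0 ∧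
    Cardinal.mk (G.induce Sᶜ).ConnectedComponent < μ

/-- The complete graph `K_κ` on `κ` vertices. -/
def cardinalCompleteGraph (κ : Cardinal.{u}) : SimpleGraph κ.out :=
  ⊤

/-! From tree to graph, take the comparability graph. A connected vertex set has a least node, and
adjacent branch sets have comparable least nodes, so a `K_κ` minor yields a chain of size `κ` and
hence a `κ`-branch. A set of fewer than `κ` nodes is bounded in height by some `α < κ`, and every
remaining component meets the fewer than `κ` nodes of height at most `α`.

From graph to tree, well-order the vertices in type `κ` and order the components of all `G - Iio a`
by reverse inclusion. Connectivity of `G` makes the levels non-empty and small. A `κ`-branch is a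
decreasing thread of components `K a`. A closing-off argument, which needs `κ` uncountable, shows
that the vertices with neighbours in every `K a` are unbounded (`exists_mem_dominating_ge`). A
recursion of length `κ` then builds a `K_κ` minor: each new branch set contains such a vertex and is
adjacent to all those used before. -/

open Cardinal Ordinal Set

/-! ### Heights and chains in trees -/

namespace IsOrderTree

variable {T : Type u} [PartialOrder T] [IsOrderTree T]

theorem le_or_ge_of_le {x y t : T} (hx : x ≤ t) (hy : y ≤ t) : x ≤ y ∨ y ≤ x := by
  rcases hx.eq_or_lt with rfl | hx
  · exact Or.inr hy
  rcases hy.eq_or_lt with rfl | hy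
  · exact Or.inl hx.le
  rcases trichotomous_of (fun a b : Iio t => a < b) ⟨x, hx⟩ ⟨y, hy⟩ with h | h | h
  · exact Or.inl (le_of_lt h)
  · exact Or.inl (congrArg Subtype.val h).le
  · exact Or.inr (le_of_lt h)

theorem nodeHeight_eq_typein {s t : T} (h : s < t) :
    nodeHeight s = typein (fun x y : Iio t => x < y) ⟨s, h⟩ := by
  refine Eq.symm ?_
  rw [← type_subrel]
  refine RelIso.ordinalType_congr ⟨⟨fun x => ⟨x.1.1, x.2⟩,
    fun x => ⟨⟨x.1, lt_trans x.2 h⟩, x.2⟩, fun _ => rfl, fun _ => rfl⟩, Iff.rfl⟩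

theorem nodeHeight_strictMono : StrictMono (nodeHeight : T → Ordinal.{u}) := fun s t h => by
  rw [nodeHeight_eq_typein h]
  exact typein_lt_type _ _

theorem exists_lt_nodeHeight_eq {t : T} {α : Ordinal.{u}} (h : α < nodeHeight t) :
    ∃ s < t, nodeHeight s = α := by
  obtain ⟨s, rfl⟩ := typein_surj _ h
  exact ⟨s.1, s.2, nodeHeight_eq_typein s.2⟩

theorem exists_le_nodeHeight_eq {t : T} {α : Ordinal.{u}} (h : α ≤ nodeHeight t) :
    ∃ s ≤ t, nodeHeight s = α := by
  rcases h.eq_or_lt with rfl | h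
  · exact ⟨t, le_rfl, rfl⟩
  · obtain ⟨s, hs, e⟩ := exists_lt_nodeHeight_eq h
    exact ⟨s, hs.le, e⟩

theorem nodeHeight_lt_height (t : T) : nodeHeight t < height T :=
  (Order.lt_succ _).trans_le (Ordinal.le_iSup (fun t : T => Order.succ (nodeHeight t)) t)

/-- In a tree all of whose nodes have height less than `κ`, a chain of size at least `κ` extends to
a `κ`-branch. -/
theorem exists_isCardinalBranch_of_isChain {κ : Cardinal.{u}}
    (hT : ∀ t : T, nodeHeight t < κ.ord) {c : Set T} (hc : IsChain (· ≤ ·) c) (hcκ : κ ≤ #c) :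
    ∃ b : Set T, IsCardinalBranch κ b := by
  obtain ⟨b, hb, hcb⟩ := hc.exists_maxChain
  refine ⟨b, hb, ?_⟩
  have : IsWellOrder b (· < ·) :=
    { trichotomous := fun x y h₁ h₂ => by
        rcases hb.1.total x.2 y.2 with h | h
        · rcases h.eq_or_lt with h | h
          · exact Subtype.ext h
          · exact (h₁ h).elim
        · rcases h.eq_or_lt with h | h
          · exact Subtype.ext h.symm
          · exact (h₂ h).elim
      wf := Subrelation.wf (fun {x y} h => nodeHeight_strictMono (show x.1 < y.1 from h))
        (InvImage.wf (fun x : b => nodeHeight x.1) Ordinal.lt_wf) }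
  have htype : type (fun x y : b => x < y) = κ.ord := by
    -- The part of `b` below a node `t` embeds in `Iio t`, which has fewer than `κ` elements; so
    -- every proper initial segment of `b` is shorter than `κ`.
    refine le_antisymm (le_of_forall_lt fun α hα => ?_) ?_
    · obtain ⟨t, rfl⟩ := typein_surj _ hα
      rw [lt_ord, card_typein]
      refine lt_of_le_of_lt ?_ (lt_ord.1 (hT t.1))
      rw [nodeHeight, card_type]
      refine mk_le_of_injective (f := fun y => ⟨y.1.1, y.2⟩) fun x y h => ?_
      exact Subtype.ext (Subtype.ext (congrArg (fun z : Iio t.1 => z.1) h))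
    · rw [ord_le, card_type]
      exact hcκ.trans (mk_le_mk_of_subset hcb)
  rw [← type_toType κ.ord, type_eq] at htype
  obtain ⟨e⟩ := htype
  have hlt : ∀ {x y : b}, e x < e y ↔ x < y := fun {x y} => e.map_rel_iff
  have hle : ∀ {x y : b}, e x ≤ e y ↔ x ≤ y := fun {x y} => by
    rw [le_iff_lt_or_eq, le_iff_lt_or_eq, hlt, e.injective.eq_iff]
  exact ⟨(⟨e.toEquiv, hle⟩ : b ≃o κ.ord.ToType).trans ToType.mk.symm⟩

end IsOrderTree

/-! ### Cardinality of Aronszajn trees -/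

namespace IsAronszajnTree

variable {κ : Cardinal.{u}} {T : Type u} [PartialOrder T] [IsOrderTree T]

open IsOrderTree

theorem nodeHeight_lt (hT : IsAronszajnTree κ T) (t : T) : nodeHeight t < κ.ord :=
  hT.height_eq ▸ nodeHeight_lt_height t

theorem iSup_succ_nodeHeight_lt (hT : IsAronszajnTree κ T) (hκ : κ.IsRegular) {S : Set T}
    (hS : #S < κ) : ⨆ t : S, Order.succ (nodeHeight t.1) < κ.ord := by
  refine iSup_lt_of_lt_cof (by rwa [hκ.cof_ord]) fun t => ?_
  exact (isSuccLimit_ord hκ.aleph0_le).succ_lt (hT.nodeHeight_lt t.1)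

theorem le_mk (hT : IsAronszajnTree κ T) (hκ : κ.IsRegular) : κ ≤ #T := by
  by_contra! h
  have := hT.iSup_succ_nodeHeight_lt hκ (S := univ) (by rwa [mk_univ])
  refine this.not_ge ?_
  rw [← hT.height_eq]
  exact Ordinal.iSup_le fun t =>
    Ordinal.le_iSup (fun t : (univ : Set T) => Order.succ (nodeHeight t.1)) ⟨t, mem_univ t⟩

theorem mk_setOf_nodeHeight_le_lt (hT : IsAronszajnTree κ T) (hκ : κ.IsRegular) {α : Ordinal.{u}}
    (hα : α < κ.ord) : #{t : T | nodeHeight t ≤ α} < κ := by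
  have h : {t : T | nodeHeight t ≤ α} ⊆
      ⋃ β : (Order.succ α).ToType, level T (ToType.mk.symm β).1 := fun t ht => by
    have ht' : nodeHeight t < Order.succ α := Order.lt_succ_iff.2 ht
    refine mem_iUnion.2 ⟨ToType.mk ⟨nodeHeight t, ht'⟩, ?_⟩
    simp [level]
  refine (mk_le_mk_of_subset h).trans_lt ?_
  rw [card_iUnion_lt_iff_forall_of_isRegular hκ]
  · exact fun β => hT.mk_level_lt _
  · rw [mk_toType, ← lt_ord]
    exact (isSuccLimit_ord hκ.aleph0_le).succ_lt hα

theorem mk_le (hT : IsAronszajnTree κ T) (hκ : κ.IsRegular) : #T ≤ κ := by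
  have h : (univ : Set T) ⊆ ⋃ β : κ.ord.ToType, level T (ToType.mk.symm β).1 := fun t _ => by
    refine mem_iUnion.2 ⟨ToType.mk ⟨nodeHeight t, hT.nodeHeight_lt t⟩, ?_⟩
    simp [level]
  rw [← mk_univ]
  refine (mk_le_mk_of_subset h).trans ((mk_iUnion_le _).trans ?_)
  rw [mk_ord_toType]
  refine (mul_le_mul_right (ciSup_le' fun β => (hT.mk_level_lt _).le) _).trans ?_
  exact (mul_eq_self hκ.aleph0_le).le

end IsAronszajnTree

/-- The comparability graph of a partial order. -/
def comparabilityGraph (T : Type u) [PartialOrder T] : SimpleGraph T where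
  Adj x y := x ≠ y ∧ (x ≤ y ∨ y ≤ x)
  symm := ⟨fun _ _ h => ⟨h.1.symm, h.2.symm⟩⟩
  loopless := ⟨fun _ h => h.1 rfl⟩

/-! ### From an Aronszajn tree to a graph -/

namespace comparabilityGraph

open IsOrderTree

variable {T : Type u} [PartialOrder T] [IsOrderTree T]

/-- A node `m` of minimal height works, because lying above `m` propagates along edges: a neighbour
below a node above `m` is comparable with `m`, and by minimality is not strictly below it. -/
theorem exists_isLeast_of_connected {X : Set T}
    (hX : ((comparabilityGraph T).induce X).Connected) : ∃ m, IsLeast X m := by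
  obtain ⟨x₀⟩ := hX.nonempty
  obtain ⟨m, -, hm⟩ := (InvImage.wf (fun x : X => nodeHeight x.1) Ordinal.lt_wf).has_min univ
    ⟨x₀, mem_univ _⟩
  refine ⟨m.1, m.2, fun y hy => ?_⟩
  have := hX.preconnected m ⟨y, hy⟩
  rw [SimpleGraph.reachable_iff_reflTransGen] at this
  refine Relation.ReflTransGen.head_induction_on (motive := fun a _ => m.1 ≤ a.1 → m.1 ≤ y)
    this (fun h => h) (fun {a c} hac _ ih hma => ih ?_) le_rfl
  rcases hac.2 with h | h
  · exact hma.trans h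
  · rcases le_or_ge_of_le hma h with h | h
    · exact h
    · rcases h.eq_or_lt with h | h
      · exact h.ge
      · exact (hm c (mem_univ _) (nodeHeight_strictMono h)).elim

theorem not_isGraphMinor {κ : Cardinal.{u}} (hT : IsAronszajnTree κ T) :
    ¬ IsGraphMinor (cardinalCompleteGraph κ) (comparabilityGraph T) := by
  rintro ⟨X, -, hdisj, hconn, hadj⟩
  choose m hm using fun a => exists_isLeast_of_connected (hconn a)
  have hinj : Function.Injective m := fun a b hab => by
    by_contra hne
    exact Set.disjoint_left.1 (hdisj a b hne) (hm a).1 (hab ▸ (hm b).1)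
  have hchain : IsChain (· ≤ ·) (range m) := by
    rintro _ ⟨a, rfl⟩ _ ⟨b, rfl⟩ hne
    obtain ⟨x, hx, y, hy, hxy⟩ := hadj a b fun h => hne (h ▸ rfl)
    rcases hxy.2 with h | h
    · exact le_or_ge_of_le (((hm a).2 hx).trans h) ((hm b).2 hy)
    · exact le_or_ge_of_le ((hm a).2 hx) (((hm b).2 hy).trans h)
  obtain ⟨b, hb⟩ := exists_isCardinalBranch_of_isChain hT.nodeHeight_lt hchain
    (by rw [mk_range_eq _ hinj, mk_out])
  exact hT.not_isCardinalBranch b hb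

theorem isCardinalConnected {κ : Cardinal.{u}} (hκ : κ.IsRegular) (hT : IsAronszajnTree κ T) :
    IsCardinalConnected κ κ (comparabilityGraph T) := by
  intro S hS
  constructor
  · have : Sᶜ.Nonempty := by
      by_contra h
      rw [not_nonempty_iff_eq_empty, compl_empty_iff] at h
      rw [h, mk_univ] at hS
      exact hS.not_ge (hT.le_mk hκ)
    obtain ⟨t, ht⟩ := this
    rw [mk_ne_zero_iff]
    exact ⟨SimpleGraph.connectedComponentMk _ ⟨t, ht⟩⟩
  · set α := ⨆ t : S, Order.succ (nodeHeight t.1) with hα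
    have hαS : ∀ t ∈ S, nodeHeight t < α := fun t ht => (Order.lt_succ _).trans_le
      (Ordinal.le_iSup (fun t : S => Order.succ (nodeHeight t.1)) ⟨t, ht⟩)
    -- `none` is a dummy value for the removed nodes. Every component is hit: a node of height at
    -- least `α` is adjacent or equal to its predecessor of height `α`, which is not in `S`.
    let f : {t : T | nodeHeight t ≤ α} →
        Option ((comparabilityGraph T).induce Sᶜ).ConnectedComponent := fun t => by
      classical
      exact if h : t.1 ∈ Sᶜ then some (SimpleGraph.connectedComponentMk _ ⟨t.1, h⟩) else none
    have hf : ∀ c, ∃ t, f t = some c := by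
      refine SimpleGraph.ConnectedComponent.ind fun t => ?_
      rcases le_total (nodeHeight t.1) α with h | h
      · exact ⟨⟨t.1, h⟩, dif_pos t.2⟩
      · obtain ⟨s, hst, hs⟩ := exists_le_nodeHeight_eq h
        have hsS : s ∈ Sᶜ := fun h => (hαS s h).ne hs
        refine ⟨⟨s, hs.le⟩, (dif_pos hsS).trans (congrArg some ?_)⟩
        rw [SimpleGraph.ConnectedComponent.eq]
        by_cases he : s = t.1
        · subst he; rfl
        · exact SimpleGraph.Adj.reachable ⟨he, Or.inl hst⟩
    choose g hg using hf
    refine (mk_le_of_injective (f := g) fun c d h => ?_).trans_lt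
      (hT.mk_setOf_nodeHeight_le_lt hκ (hT.iSup_succ_nodeHeight_lt hκ hS))
    exact Option.some_injective _ (by rw [← hg c, ← hg d, h])

end comparabilityGraph

/-! ### Connected induced subgraphs -/

namespace SimpleGraph

variable {V : Type u} {G : SimpleGraph V}

/-- Any small set of vertices of a connected induced subgraph lies in a small connected set. -/
theorem exists_connected_superset_mk_lt {κ : Cardinal.{u}} (hκ : κ.IsRegular) {K W : Set V}
    (hK : (G.induce K).Connected) (hWK : W ⊆ K) (hW : #W < κ) (hne : W.Nonempty) :
    ∃ X, W ⊆ X ∧ X ⊆ K ∧ #X < κ ∧ (G.induce X).Connected := by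
  obtain ⟨u, hu⟩ := hne
  -- Join each `w` to the fixed vertex `u` by a finite path inside `K`; the union of these paths is
  -- the required set.
  have hP : ∀ w : W, ∃ P ⊆ K, u ∈ P ∧ w.1 ∈ P ∧ P.Finite ∧ (G.induce P).Connected := fun w => by
    obtain ⟨p⟩ := hK.preconnected ⟨u, hWK hu⟩ ⟨w.1, hWK w.2⟩
    refine ⟨{v | v ∈ (p.map (Embedding.induce K).toHom).support}, fun v hv => ?_, ?_, ?_,
      List.finite_toSet _, Walk.connected_induce_support _⟩
    · rw [mem_ofPred_eq, Walk.support_map, List.mem_map] at hv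
      obtain ⟨v, -, rfl⟩ := hv
      exact v.2
    · exact Walk.start_mem_support _
    · exact Walk.end_mem_support _
  choose P hPK huP hwP hPfin hPconn using hP
  refine ⟨⋃ w, P w, fun w hw => mem_iUnion.2 ⟨⟨w, hw⟩, hwP _⟩, iUnion_subset hPK, ?_, ?_⟩
  · rw [card_iUnion_lt_iff_forall_of_isRegular hκ hW]
    exact fun w => (hPfin w).lt_aleph0.trans_le hκ.aleph0_le
  · refine G.induce_connected_of_patches u (mem_iUnion.2 ⟨⟨u, hu⟩, huP _⟩) fun {v} hv => ?_
    obtain ⟨w, hw⟩ := mem_iUnion.1 hv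
    exact ⟨P w, subset_iUnion P w, huP w, hw, (hPconn w).preconnected _ _⟩

/-- In a connected induced subgraph, an edge leaves any nonempty proper subset. -/
theorem exists_adj_of_connected_induce {K L : Set V} (hK : (G.induce K).Connected) {x y : V}
    (hxK : x ∈ K) (hx : x ∉ L) (hyK : y ∈ K) (hy : y ∈ L) :
    ∃ v ∈ K, ∃ w ∈ K, v ∉ L ∧ w ∈ L ∧ G.Adj v w := by
  by_contra! h
  have := hK.preconnected ⟨x, hxK⟩ ⟨y, hyK⟩
  rw [reachable_iff_reflTransGen] at this
  refine Relation.ReflTransGen.head_induction_on (motive := fun a _ => a.1 ∉ L → y ∉ L)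
    this (fun h => h) (fun {a c} hac _ ih ha => ih fun hc => ?_) hx hy
  exact h a.1 a.2 c.1 c.2 ha hc hac

end SimpleGraph

/-! ### Well-orders of regular type -/

section RegularType

variable {V : Type u} [LinearOrder V] [WellFoundedLT V] {κ : Cardinal.{u}}

theorem mk_Iio_lt_of_type_eq_ord (hV : typeLT V = κ.ord) (a : V) : #(Iio a) < κ := by
  have h : #V = κ := by rw [← card_ord κ, ← hV, card_type]
  rw [← h]
  exact mk_Iio_lt a (by rw [h, hV])

/-- Otherwise `V` would be a union of fewer than `κ` initial segments, each smaller than `κ`,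
against regularity. -/
theorem exists_forall_lt_of_mk_lt (hκ : κ.IsRegular) (hV : typeLT V = κ.ord) {s : Set V}
    (hs : #s < κ) : ∃ a, ∀ x ∈ s, x < a := by
  by_contra! h
  have hlt : #(⋃ x : s, Iic x.1) < κ := by
    rw [card_iUnion_lt_iff_forall_of_isRegular hκ hs]
    intro x
    rw [← Iio_insert]
    exact mk_insert_le.trans_lt (add_lt_of_lt hκ.aleph0_le (mk_Iio_lt_of_type_eq_ord hV _)
      (one_lt_aleph0.trans_le hκ.aleph0_le))
  have huniv : ⋃ x : s, Iic x.1 = Set.univ := eq_univ_of_forall fun a => by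
    obtain ⟨x, hx, hax⟩ := h a
    exact mem_iUnion.2 ⟨⟨x, hx⟩, hax⟩
  rw [huniv, mk_univ, ← card_ord κ, ← hV, card_type] at hlt
  exact hlt.false

/-- Take `a` to be the supremum of the iterates of a function `g` with `f v < g x` for all `v ≤ x`.
Uncountable cofinality bounds the iterates, and any `v < a` lies below one of them. -/
theorem exists_closed_under (hκ : κ.IsRegular) (hκ' : ℵ₀ < κ) (hV : typeLT V = κ.ord)
    (f : V → V) (x₀ : V) : ∃ a, x₀ < a ∧ ∀ v < a, f v ≤ a := by
  have hg : ∀ x, ∃ y, ∀ v ≤ x, f v < y := fun x => by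
    obtain ⟨x', hx'⟩ := exists_forall_lt_of_mk_lt hκ hV (s := {x})
      (by rw [mk_singleton]; exact one_lt_aleph0.trans hκ')
    have := exists_forall_lt_of_mk_lt hκ hV (s := f '' Iio x')
      (mk_image_le.trans_lt (mk_Iio_lt_of_type_eq_ord hV _))
    obtain ⟨y, hy⟩ := this
    exact ⟨y, fun v hv => hy _ ⟨v, hv.trans_lt (hx' x rfl), rfl⟩⟩
  choose g hg using hg
  have hbdd : {a | ∀ n : ℕ, g^[n] x₀ < a}.Nonempty := by
    obtain ⟨a, ha⟩ := exists_forall_lt_of_mk_lt hκ hV (s := range fun n : ℕ => g^[n] x₀)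
      ((countable_range _).le_aleph0.trans_lt hκ')
    exact ⟨a, fun n => ha _ ⟨n, rfl⟩⟩
  obtain ⟨a, ha, hmin⟩ := wellFounded_lt.has_min _ hbdd
  refine ⟨a, ha 0, fun v hv => ?_⟩
  obtain ⟨n, hn⟩ : ∃ n : ℕ, v ≤ g^[n] x₀ := by
    by_contra! h
    exact hmin v h hv
  have := ha (n + 1)
  rw [Function.iterate_succ_apply'] at this
  exact ((hg _ v hn).trans this).le

end RegularType

/-- A decreasing family `K` of components: `K a` is a component of the graph obtained by removing
all vertices below `a`. -/
structure IsComponentThread {V : Type u} [LinearOrder V] (G : SimpleGraph V) (K : V → Set V) :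
    Prop where
  antitone : Antitone K
  connected (a : V) : (G.induce (K a)).Connected
  le_of_mem {a v : V} : v ∈ K a → a ≤ v
  mem_of_adj {a v w : V} : v ∈ K a → a ≤ w → G.Adj v w → w ∈ K a

/-! ### A thread of components yields a complete minor -/

namespace IsComponentThread

variable {V : Type u} [LinearOrder V] {G : SimpleGraph V} {K : V → Set V}

/-- The vertices which have a neighbour in every member of the thread. -/
def dominating (G : SimpleGraph V) (K : V → Set V) : Set V :=
  {v | ∀ a, ∃ w ∈ K a, G.Adj v w}

theorem nonempty (hK : IsComponentThread G K) (a : V) : (K a).Nonempty :=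
  nonempty_subtype.1 (hK.connected a).nonempty

theorem mem_of_mem_dominating (hK : IsComponentThread G K) {a d : V}
    (hd : d ∈ dominating G K) (had : a ≤ d) : d ∈ K a := by
  obtain ⟨w, hw, hdw⟩ := hd a
  exact hK.mem_of_adj hw had hdw.symm

variable [WellFoundedLT V] {κ : Cardinal.{u}}

/-- If no dominating vertex is at least `a`, let `f v` be an index at which a non-dominating `v` has
lost all its neighbours, and let `b` be closed under `f`. Connectedness of `K a` gives an edge from
some `v` outside `K b` into `K b`. Then `v < b`, so `f v ≤ b`, yet `v` has a neighbour in `K b ⊆ K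
(f v)`. -/
theorem exists_mem_dominating_ge (hK : IsComponentThread G K) (hκ : κ.IsRegular) (hκ' : ℵ₀ < κ)
    (hV : typeLT V = κ.ord) (a : V) : ∃ d ∈ dominating G K, a ≤ d := by
  by_contra! h
  have hf : ∀ v, ∃ b, v ∉ dominating G K → ∀ w ∈ K b, ¬ G.Adj v w := fun v => by
    by_cases hv : v ∈ dominating G K
    · exact ⟨v, fun h => (h hv).elim⟩
    · simp only [dominating, mem_ofPred_eq, not_forall, not_exists, not_and] at hv
      obtain ⟨b, hb⟩ := hv
      exact ⟨b, fun _ => hb⟩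
  choose f hf using hf
  obtain ⟨x, hx⟩ := hK.nonempty a
  obtain ⟨b, hxb, hb⟩ := exists_closed_under hκ hκ' hV f x
  have hab : a ≤ b := (hK.le_of_mem hx).trans hxb.le
  obtain ⟨y, hy⟩ := hK.nonempty b
  obtain ⟨v, hvK, w, -, hv, hw, hvw⟩ := G.exists_adj_of_connected_induce (hK.connected a) hx
    (fun h => (hK.le_of_mem h).not_gt hxb) (hK.antitone hab hy) hy
  have hvb : v < b := by
    by_contra! hbv
    exact hv (hK.mem_of_adj hw hbv hvw.symm)
  have hvD : v ∉ dominating G K := fun hD => (h v hD).not_ge (hK.le_of_mem hvK)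
  exact hf v hvD w (hK.antitone (hb v hvb) hw) hvw

/-- The successor step of the minor construction. For `a` above all of `A`, the component `K a`
avoids `A`, contains a dominating vertex, and has neighbours of all dominating vertices in `A`; a
small connected part of it suffices. -/
theorem exists_extension (hK : IsComponentThread G K) (hκ : κ.IsRegular) (hκ' : ℵ₀ < κ)
    (hV : typeLT V = κ.ord) {A : Set V} (hA : #A < κ) :
    ∃ X : Set V, #X < κ ∧ (X ∩ dominating G K).Nonempty ∧ Disjoint X A ∧
      (G.induce X).Connected ∧ ∀ d ∈ A ∩ dominating G K, ∃ w ∈ X, G.Adj d w := by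
  obtain ⟨a, ha⟩ := exists_forall_lt_of_mk_lt hκ hV hA
  obtain ⟨d, hd, had⟩ := hK.exists_mem_dominating_ge hκ hκ' hV a
  have hw : ∀ e : ↥(A ∩ dominating G K), ∃ w ∈ K a, G.Adj e.1 w := fun e => e.2.2 a
  choose w hwK hw using hw
  obtain ⟨X, hWX, hXK, hX, hconn⟩ := G.exists_connected_superset_mk_lt hκ (hK.connected a)
    (W := insert d (range w))
    (insert_subset (hK.mem_of_mem_dominating hd had) (range_subset_iff.2 hwK))
    (mk_insert_le.trans_lt (add_lt_of_lt hκ.aleph0_le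
      (mk_range_le.trans_lt ((mk_le_mk_of_subset inter_subset_left).trans_lt hA))
      (one_lt_aleph0.trans hκ'))) (insert_nonempty _ _)
  refine ⟨X, hX, ⟨d, hWX (mem_insert _ _), hd⟩, ?_, hconn, fun e he =>
    ⟨w ⟨e, he⟩, hWX (mem_insert_of_mem _ ⟨_, rfl⟩), hw ⟨e, he⟩⟩⟩
  exact Set.disjoint_left.2 fun x hx hxA => (hK.le_of_mem (hXK hx)).not_gt (ha x hxA)

theorem isGraphMinor (hK : IsComponentThread G K) (hκ : κ.IsRegular) (hκ' : ℵ₀ < κ)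
    (hV : typeLT V = κ.ord) : IsGraphMinor (cardinalCompleteGraph κ) G := by
  have hF : ∀ A : Set V, ∃ X : Set V, #A < κ → #X < κ ∧ (X ∩ dominating G K).Nonempty ∧
      Disjoint X A ∧ (G.induce X).Connected ∧
        ∀ d ∈ A ∩ dominating G K, ∃ w ∈ X, G.Adj d w := fun A => by
    by_cases hA : #A < κ
    · obtain ⟨X, hX⟩ := hK.exists_extension hκ hκ' hV hA
      exact ⟨X, fun _ => hX⟩
    · exact ⟨∅, fun h => (hA h).elim⟩
  choose F hF using hF
  let X : V → Set V := wellFounded_lt.fix fun a X => F (⋃ b : Iio a, X b.1 b.2)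
  have hX : ∀ a, X a = F (⋃ b : Iio a, X b.1) := fun a => wellFounded_lt.fix_eq _ a
  -- `F` is meaningful only on small sets, so smallness of all earlier stages has to be carried
  -- through the recursion.
  have hsmall : ∀ a, #(⋃ b : Iio a, X b.1) < κ := fun a => by
    induction a using WellFoundedLT.induction with
    | _ a ih =>
      rw [card_iUnion_lt_iff_forall_of_isRegular hκ (mk_Iio_lt_of_type_eq_ord hV a)]
      intro b
      rw [hX]
      exact (hF _ (ih b.1 b.2)).1
  have hXF : ∀ a, #(X a) < κ ∧ (X a ∩ dominating G K).Nonempty ∧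
      Disjoint (X a) (⋃ b : Iio a, X b.1) ∧ (G.induce (X a)).Connected ∧
        ∀ d ∈ (⋃ b : Iio a, X b.1) ∩ dominating G K, ∃ w ∈ X a, G.Adj d w := fun a => by
    have := hF _ (hsmall a)
    rwa [← hX] at this
  have hsub : ∀ {a b}, b < a → X b ⊆ ⋃ b : Iio a, X b.1 := fun {a b} h =>
    subset_iUnion (fun b : Iio a => X b.1) ⟨b, h⟩
  have hdisj : ∀ {a b}, b < a → Disjoint (X a) (X b) := fun {a b} h =>
    (hXF a).2.2.1.mono_right (hsub h)
  have hadj : ∀ {a b}, b < a → ∃ x ∈ X b, ∃ y ∈ X a, G.Adj x y := fun {a b} h => by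
    obtain ⟨d, hdX, hd⟩ := (hXF b).2.1
    obtain ⟨w, hw, hdw⟩ := (hXF a).2.2.2.2 d ⟨hsub h hdX, hd⟩
    exact ⟨d, hdX, w, hw, hdw⟩
  obtain ⟨e⟩ : Nonempty (κ.out ≃ V) := by
    rw [← Cardinal.eq, mk_out, ← card_ord κ, ← hV, card_type]
  refine ⟨fun i => X (e i), fun i => (hXF _).2.1.mono inter_subset_left, fun i j hij => ?_,
    fun i => (hXF _).2.2.2.1, fun i j hij => ?_⟩
  · rcases lt_or_gt_of_ne (e.injective.ne hij) with h | h
    · exact (hdisj h).symm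
    · exact hdisj h
  · rcases lt_or_gt_of_ne (e.injective.ne hij.ne) with h | h
    · exact hadj h
    · obtain ⟨x, hx, y, hy, hxy⟩ := hadj h
      exact ⟨y, hy, x, hx, hxy.symm⟩

end IsComponentThread

/-- The nodes of the component tree of a graph on a linearly ordered vertex set: the components of
the graphs obtained by removing all vertices below a given vertex. -/
structure ComponentTree {V : Type u} [LinearOrder V] (G : SimpleGraph V) : Type u where
  index : V
  component : (G.induce (Iio index)ᶜ).ConnectedComponent

/-! ### The component tree of a graph -/

namespace ComponentTree

variable {V : Type u} [LinearOrder V] {G : SimpleGraph V}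

/-- The component of `G - Iio a` which contains a given component of `G - Iio b`. -/
def restrict {a b : V} (h : a ≤ b) (c : (G.induce (Iio b)ᶜ).ConnectedComponent) :
    (G.induce (Iio a)ᶜ).ConnectedComponent :=
  c.map (G.induceHomOfLE (compl_subset_compl.2 (Iio_subset_Iio h))).toHom

theorem restrict_self {a : V} (c : (G.induce (Iio a)ᶜ).ConnectedComponent) :
    restrict le_rfl c = c :=
  c.ind fun _ => rfl

theorem restrict_restrict {a b c : V} (hab : a ≤ b) (hbc : b ≤ c)
    (x : (G.induce (Iio c)ᶜ).ConnectedComponent) :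
    restrict hab (restrict hbc x) = restrict (hab.trans hbc) x :=
  x.ind fun _ => rfl

instance : PartialOrder (ComponentTree G) where
  le x y := ∃ h : x.index ≤ y.index, restrict h y.component = x.component
  le_refl x := ⟨le_rfl, restrict_self _⟩
  le_trans := fun x y z ⟨h, e⟩ ⟨h', e'⟩ =>
    ⟨h.trans h', by rw [← e, ← e', restrict_restrict]⟩
  le_antisymm := by
    rintro ⟨a, c⟩ ⟨b, d⟩ ⟨h, e⟩ ⟨h', -⟩
    obtain rfl : a = b := le_antisymm h h'
    rw [restrict_self] at e
    exact congrArg _ e.symm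

theorem eq_of_le_of_index_eq {x y : ComponentTree G} (h : x ≤ y) (he : x.index = y.index) :
    x = y := by
  obtain ⟨a, c⟩ := x
  obtain ⟨b, d⟩ := y
  obtain rfl : a = b := he
  obtain ⟨h, e⟩ := h
  rw [restrict_self] at e
  exact congrArg _ e.symm

theorem index_lt_index {x y : ComponentTree G} (h : x < y) : x.index < y.index :=
  h.le.1.lt_of_ne fun e => h.ne (eq_of_le_of_index_eq h.le e)

theorem le_of_le_of_index_le {x y t : ComponentTree G} (hx : x ≤ t) (hy : y ≤ t)
    (h : x.index ≤ y.index) : x ≤ y := by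
  obtain ⟨hx, ex⟩ := hx
  obtain ⟨hy, ey⟩ := hy
  exact ⟨h, by rw [← ey, restrict_restrict, ex]⟩

theorem lt_of_le_of_index_lt {x y t : ComponentTree G} (hx : x ≤ t) (hy : y ≤ t)
    (h : x.index < y.index) : x < y :=
  (le_of_le_of_index_le hx hy h.le).lt_of_ne fun e => h.ne (congrArg index e)

variable [WellFoundedLT V]

instance : IsOrderTree (ComponentTree G) where
  isWellOrder_Iio t :=
    { trichotomous := fun x y h₁ h₂ => Subtype.ext <| by
        rcases lt_trichotomy x.1.index y.1.index with h | h | h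
        · exact (h₁ (lt_of_le_of_index_lt x.2.le y.2.le h)).elim
        · exact eq_of_le_of_index_eq (le_of_le_of_index_le x.2.le y.2.le h.le) h
        · exact (h₂ (lt_of_le_of_index_lt y.2.le x.2.le h)).elim
      wf := Subrelation.wf (fun {x y} h => index_lt_index (show x.1 < y.1 from h))
        (InvImage.wf (fun x : Iio t => x.1.index) wellFounded_lt) }

/-- Below `t` there is exactly one node for each smaller index, namely the component that contains
that of `t`. -/
theorem nodeHeight_eq (t : ComponentTree G) :
    IsOrderTree.nodeHeight t = typein (fun a b : V => a < b) t.index := by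
  rw [← type_subrel]
  refine RelIso.ordinalType_congr
    ⟨Equiv.ofBijective (fun x : Iio t => (⟨x.1.index, index_lt_index x.2⟩ : Iio t.index))
      ⟨fun x y h => Subtype.ext ?_, fun a => ?_⟩, fun {x y} => ⟨fun h => ?_, fun h => ?_⟩⟩
  · have h : x.1.index = y.1.index := congrArg Subtype.val h
    exact eq_of_le_of_index_eq (le_of_le_of_index_le x.2.le y.2.le h.le) h
  · have h : a.1 ≤ t.index := le_of_lt a.2
    exact ⟨⟨⟨a.1, restrict h t.component⟩, lt_of_le_of_index_lt ⟨h, rfl⟩ le_rfl a.2⟩, rfl⟩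
  · exact lt_of_le_of_index_lt (le_of_lt x.2) (le_of_lt y.2) h
  · exact index_lt_index h

variable {κ : Cardinal.{u}}

theorem height_eq (hV : typeLT V = κ.ord) (hG : IsCardinalConnected κ κ G) :
    IsOrderTree.height (ComponentTree G) = κ.ord := by
  refine le_antisymm (Ordinal.iSup_le fun t => ?_) (le_of_forall_lt fun α hα => ?_)
  · rw [nodeHeight_eq, Order.succ_le_iff, ← hV]
    exact typein_lt_type _ _
  · rw [← hV] at hα
    obtain ⟨a, rfl⟩ := typein_surj _ hα
    obtain ⟨c⟩ := mk_ne_zero_iff.1 (hG (Iio a) (mk_Iio_lt_of_type_eq_ord hV a)).1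
    have := IsOrderTree.nodeHeight_lt_height (⟨a, c⟩ : ComponentTree G)
    rwa [nodeHeight_eq] at this

theorem mk_level_lt (hκ : κ.IsRegular) (hV : typeLT V = κ.ord) (hG : IsCardinalConnected κ κ G)
    (α : Ordinal.{u}) : #(IsOrderTree.level (ComponentTree G) α) < κ := by
  rcases (IsOrderTree.level (ComponentTree G) α).eq_empty_or_nonempty with h | ⟨t₀, ht₀⟩
  · rw [h, mk_eq_zero]
    exact hκ.pos
  · have hidx : ∀ t : IsOrderTree.level (ComponentTree G) α, t.1.index = t₀.index := fun t => by
      have := t.2.trans ht₀.symm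
      rwa [nodeHeight_eq, nodeHeight_eq, typein_inj] at this
    refine (mk_le_of_injective (f := fun t => restrict (hidx t).ge t.1.component)
      fun s t hst => Subtype.ext ?_).trans_lt
      (hG (Iio t₀.index) (mk_Iio_lt_of_type_eq_ord hV _)).2
    have hs := hidx s
    have ht := hidx t
    obtain ⟨⟨a, c⟩, _⟩ := s
    obtain ⟨⟨b, d⟩, _⟩ := t
    obtain rfl : a = t₀.index := hs
    obtain rfl : b = t₀.index := ht
    simp only [restrict_self] at hst
    exact congrArg (ComponentTree.mk _) hst

theorem exists_isComponentThread (hV : typeLT V = κ.ord)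
    {b : Set (ComponentTree G)} (hb : IsCardinalBranch κ b) :
    ∃ K, IsComponentThread G K := by
  have hbκ : #b = κ := by
    obtain ⟨e⟩ := hb.2
    rw [mk_congr (e.toEquiv.trans ToType.mk.toEquiv), mk_ord_toType]
  have hinj : InjOn index b := fun x hx y hy h => by
    rcases hb.1.1.total hx hy with hle | hle
    · exact eq_of_le_of_index_eq hle h
    · exact (eq_of_le_of_index_eq hle h.symm).symm
  -- The indices along the branch are `κ` distinct vertices, too many to fit below `a`.
  have hunb : ∀ a, ∃ x ∈ b, a ≤ x.index := fun a => by
    by_contra! h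
    refine (mk_Iio_lt_of_type_eq_ord hV a).not_ge ?_
    rw [← hbκ, ← mk_image_eq_of_injOn _ _ hinj]
    exact mk_le_mk_of_subset (image_subset_iff.2 h)
  choose x hxb hx using hunb
  -- The branch need not be known to have a node of index `a`, so a later node is restricted to `a`;
  -- by `hc` these choices cohere.
  let c : ∀ a, (G.induce (Iio a)ᶜ).ConnectedComponent := fun a => restrict (hx a) (x a).component
  have hc : ∀ {a a'} (h : a ≤ a'), restrict h (c a') = c a := fun {a a'} h => by
    simp only [c, restrict_restrict]
    rcases hb.1.1.total (hxb a) (hxb a') with ⟨h', e⟩ | ⟨h', e⟩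
    · rw [← e, restrict_restrict]
    · rw [← e, restrict_restrict]
  refine ⟨fun a => Subtype.val '' (c a).supp, ?_, fun a => ?_, ?_, ?_⟩
  · rintro a a' h _ ⟨v, hv, rfl⟩
    refine ⟨⟨v.1, fun hva => v.2 (lt_of_lt_of_le hva h)⟩, ?_, rfl⟩
    rw [SimpleGraph.ConnectedComponent.mem_supp_iff] at hv ⊢
    rw [← hc h, ← hv]
    rfl
  · refine (c a).connected_toSimpleGraph.map
      (⟨fun v => ⟨v.1.1, v.1, v.2, rfl⟩, fun h => h⟩ :
        (c a).toSimpleGraph →g G.induce (Subtype.val '' (c a).supp)) ?_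
    rintro ⟨_, v, hv, rfl⟩
    exact ⟨⟨v, hv⟩, rfl⟩
  · rintro a _ ⟨v, -, rfl⟩
    exact not_lt.1 v.2
  · rintro a _ w ⟨v, hv, rfl⟩ haw hvw
    exact ⟨⟨w, not_lt.2 haw⟩, (c a).mem_supp_of_adj_mem_supp hv hvw, rfl⟩

theorem isAronszajnTree (hκ : κ.IsRegular) (hκ' : ℵ₀ < κ) (hV : typeLT V = κ.ord)
    (hG : IsCardinalConnected κ κ G) (hminor : ¬ IsGraphMinor (cardinalCompleteGraph κ) G) :
    IsAronszajnTree κ (ComponentTree G) where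
  height_eq := height_eq hV hG
  mk_level_lt := mk_level_lt hκ hV hG
  not_isCardinalBranch _ hb := by
    obtain ⟨K, hK⟩ := exists_isComponentThread hV hb
    exact hminor (hK.isGraphMinor hκ hκ' hV)

end ComponentTree

theorem mainTheorem4 (κ : Cardinal.{u}) (hκ : κ.IsRegular) (hκ' : Cardinal.aleph0 < κ) :
    (∃ (T : Type u) (_ : PartialOrder T) (_ : IsOrderTree T), IsAronszajnTree κ T) ↔
      ∃ (V : Type u) (G : SimpleGraph V),
        Cardinal.mk V = κ ∧ IsCardinalConnected κ κ G ∧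
          ¬ IsGraphMinor (cardinalCompleteGraph κ) G := by
  constructor
  · rintro ⟨T, _, _, hT⟩
    exact ⟨T, comparabilityGraph T, le_antisymm (hT.mk_le hκ) (hT.le_mk hκ),
      comparabilityGraph.isCardinalConnected hκ hT, comparabilityGraph.not_isGraphMinor hT⟩
  · rintro ⟨V, G, rfl, hG, hminor⟩
    obtain ⟨_, _, hV⟩ := exists_ord_eq_type_lt V
    exact ⟨ComponentTree G, inferInstance, inferInstance,
      ComponentTree.isAronszajnTree hκ hκ' hV.symm hG hminor⟩
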